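/- Let $M\le N$ and $\mathbf T^N=\mathbf R^N/\mathbf Z^N$; functions on $\mathbf T^N$ are identified with $\mathbf Z^N$-periodic functions on $\mathbf R^N$. Let $\beta:\mathbf R^M\to\mathbf R^N$ be continuous with $\beta(cz)=c\,\beta(z)$ for all $c>0$ and $|\beta(z)|\le B_1|z|$ for all $z\in\mathbf R^M$, where $B_1>0$ is a constant. Let $dq_0(z)=q_0(z)\,dz$ with $q_0\ge 0$ measurable on $\mathbf R^M$. Let $a,f_0:\mathbf R^N\to\mathbf R$ be $\mathbf Z^N$-periodic and such that, for some constants $a_0,L>0$ and $\theta_1,\theta_2\in(0,1]$, $$a(y)\ge a_0,\qquad |a(y)-a(y')|\le L|y-y'|^{\theta_1},\qquad |f_0(y)-f_0(y')|\le L|y-y'|^{\theta_2}\qquad (y,y'\in\mathbf R^N).$$ Consider one of the following two cases. For functions $u:\mathbf R^N\to\mathbf R$, points $y$ and vectors $p\in\mathbf R^N$, put (1) $\gamma=2$ and $\Delta_z[u,p](y)=u(y+\beta(z))-u(y)-\langle p,\beta(z)\rangle$; (2) $\gamma=1$ and $\Delta_z[u,p](y)=u(y+\beta(z))-u(y)$.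 In each case assume $$\int_{|z|<1}|z|^{\gamma}\,dq_0(z)+\int_{|z|\ge1}|z|^{\gamma-1}\,dq_0(z)<\infty .$$ Assume also condition (B): for any $y,y'\in\mathbf T^N$ there are finitely many points $y_1,\dots,y_m\in\mathbf T^N$ with $y_1=y$, $y_m=y'$ such that, for any $\varepsilon_1,\dots,\varepsilon_m>0$, there are measurable sets $J_i\subset\operatorname{supp}(dq_0)$ $(1\le i\le m-1)$ with $\int_{J_i}dq_0>0$ and $y_i+\beta(z)\in B_{\varepsilon_i}(y_{i+1})$ in $\mathbf T^N$ for all $z\in J_i$. Given a continuous $F:\mathbf R^N\times\mathbf R\to\mathbf R$ and $c\in\mathbf R$, a viscosity subsolution in $\mathbf T^N$ of $$F(y,u(y))-a(y)\int_{\mathbf R^M}\Delta_z[u,\nabla u(y)](y)\,dq_0(z)\le c$$ is a periodic upper semicontinuous function $u:\mathbf R^N\to\mathbf R$ such that, for every $y\in\mathbf R^N$ and every $\phi\in C^2(\mathbf R^N)$ with $\phi(y)=u(y)$ and $u\le\phi$ on $\mathbf R^N$, the function $z\mapsto\Delta_z[u,\nabla\phi(y)](y)$ belongs to $L^1(\mathbf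 R^M,dq_0)$ and $$F(y,u(y))-a(y)\int_{\mathbf R^M}\Delta_z[u,\nabla\phi(y)](y)\,dq_0(z)\le c .$$ Viscosity supersolutions of the inequality with $\ge c$ are defined likewise, with lower semicontinuous $u$, with $u\ge\phi$, and with the last inequality reversed. A viscosity solution of the equation with $=c$ is both a viscosity subsolution of the inequality with $\le c$ and a viscosity supersolution of the inequality with $\ge c$. **Theorem 3.1.** For every $\lambda>0$ let $v_\lambda$ be a periodic viscosity solution of $$\lambda v_\lambda(y)-a(y)\int_{\mathbf R^M}\Delta_z[v_\lambda,\nabla v_\lambda(y)](y)\,dq_0(z)-f_0(y)=0\quad\text{in }\mathbf T^N .$$ Then there exists a unique real number $d$ such that $$\lim_{\lambda\downarrow0}\lambda v_\lambda(y)=d\quad\text{uniformly in }\mathbf T^N .$$ Moreover $d$ is characterized by the following property, in the sense that $d$ is the only real number that has it: for any $\delta>0$ there exist a periodic viscosity subsolution $v_\delta$ of $$d-a(y)\int_{\mathbf R^M}\Delta_z[v_\delta,\nabla v_\delta(y)](y)\,dq_0(z)-f_0(y)\le\delta\quad\text{in }\mathbf T^N$$ and a periodic viscosity supersolution $v^\delta$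 of $$d-a(y)\int_{\mathbf R^M}\Delta_z[v^\delta,\nabla v^\delta(y)](y)\,dq_0(z)-f_0(y)\ge-\delta\quad\text{in }\mathbf T^N .$$ -/

import Mathlib

open MeasureTheory Filter Topology
open scoped ENNReal

namespace LevyErgodic

/-- The Euclidean space `ℝⁿ`. -/
abbrev E (n : ℕ) : Type := EuclideanSpace ℝ (Fin n)

/-- The point of `ℝᴺ` with the integer coordinates `k`. -/
noncomputable def intVec {N : ℕ} (k : Fin N → ℤ) : E N :=
  WithLp.toLp 2 (fun i => (k i : ℝ))

/-- Functions on the torus `𝕋ᴺ = ℝᴺ / ℤᴺ` are the `ℤᴺ`-periodic functions on `ℝᴺ`. -/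
def Periodic {N : ℕ} (u : E N → ℝ) : Prop :=
  ∀ (k : Fin N → ℤ) (y : E N), u (y + intVec k) = u y

/-- The points of `ℝᴺ` whose class in `𝕋ᴺ` lies in the open ball of radius `r` centred at the class
of `c`. -/
def torusBall {N : ℕ} (c : E N) (r : ℝ) : Set (E N) :=
  {x | ∃ k : Fin N → ℤ, x + intVec k ∈ Metric.ball c r}

/-- The two forms of the Lévy operator: with the increments `u(y+β(z)) - u(y) - ⟨∇u(y), β(z)⟩`
(`compensated`), or with the increments `u(y+β(z)) - u(y)` (`plain`). -/
inductive Form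
  | compensated
  | plain

/-- The exponent `γ` of the integrability condition that goes with each form. -/
def Form.order : Form → ℕ
  | .compensated => 2
  | .plain => 1

/-- The integrand of the Lévy operator at `y`; the vector `p` stands for the gradient at `y`. -/
noncomputable def increment {M N : ℕ} (form : Form) (β : E M → E N) (u : E N → ℝ) (y p : E N)
    (z : E M) : ℝ :=
  match form with
  | .compensated => u (y + β z) - u y - inner ℝ p (β z)
  | .plain => u (y + β z) - u y

/-- The measure `dq₀(z) = q₀(z) dz`. -/
noncomputable def densityMeasure {M : ℕ} (q₀ : E M → ℝ) : Measure (E M) :=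
  volume.withDensity (fun z => ENNReal.ofReal (q₀ z))

/-- `∫_{|z| < 1} |z|^γ dμ + ∫_{|z| ≥ 1} |z|^(γ-1) dμ < ∞` (used with `γ = 1, 2` only). -/
def LevyIntegrable {M : ℕ} (γ : ℕ) (μ : Measure (E M)) : Prop :=
  (∫⁻ z in {z : E M | ‖z‖ < 1}, ‖z‖ₑ ^ γ ∂μ) + (∫⁻ z in {z : E M | 1 ≤ ‖z‖}, ‖z‖ₑ ^ (γ - 1) ∂μ) < ∞

/-- Condition (B), controllability on `𝕋ᴺ` of the jump process `y ↦ y + β(z)`, `z ∈ supp μ`: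
any two points are joined by a finite chain of points of the torus, each of which is reached from
the preceding one, up to an arbitrarily small error, by jumps of positive `μ`-measure. -/
def Controllable {M N : ℕ} (β : E M → E N) (μ : Measure (E M)) : Prop :=
  ∀ y y' : E N, ∃ (m : ℕ) (p : Fin (m + 1) → E N),
    p 0 = y ∧ (∃ k : Fin N → ℤ, p (Fin.last m) = y' + intVec k) ∧
    ∀ ε : Fin (m + 1) → ℝ, (∀ i, 0 < ε i) →
      ∀ i : Fin m, ∃ J : Set (E M), MeasurableSet J ∧ J ⊆ μ.support ∧
        (∀ z ∈ J, p i.castSucc + β z ∈ torusBall (p i.succ) (ε i.castSucc)) ∧ 0 < μ J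

/-- `u` is a viscosity subsolution of
`F(y, u(y)) - a(y) ∫ (increment of u at y) dμ ≤ c` in `ℝᴺ`: it is upper semicontinuous and, whenever
a `C²` function `φ` touches it from above at `y` (`u - φ` has a global maximum there, with value
`0`), the increment with `∇φ(y)` in the place of the gradient is `μ`-integrable and the inequality
holds. -/
def IsViscositySubsolution {M N : ℕ} (form : Form) (β : E M → E N) (μ : Measure (E M))
    (a : E N → ℝ) (F : E N → ℝ → ℝ) (c : ℝ) (u : E N → ℝ) : Prop :=
  UpperSemicontinuous u ∧
  ∀ (y : E N) (φ : E N → ℝ), ContDiff ℝ 2 φ → u y = φ y → (∀ x, u x ≤ φ x) →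
    Integrable (increment form β u y (gradient φ y)) μ ∧
    F y (u y) - a y * ∫ z, increment form β u y (gradient φ y) z ∂μ ≤ c

/-- `u` is a viscosity supersolution of
`F(y, u(y)) - a(y) ∫ (increment of u at y) dμ ≥ c` in `ℝᴺ`. -/
def IsViscositySupersolution {M N : ℕ} (form : Form) (β : E M → E N) (μ : Measure (E M))
    (a : E N → ℝ) (F : E N → ℝ → ℝ) (c : ℝ) (u : E N → ℝ) : Prop :=
  LowerSemicontinuous u ∧
  ∀ (y : E N) (φ : E N → ℝ), ContDiff ℝ 2 φ → u y = φ y → (∀ x, φ x ≤ u x) →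
    Integrable (increment form β u y (gradient φ y)) μ ∧
    c ≤ F y (u y) - a y * ∫ z, increment form β u y (gradient φ y) z ∂μ

/-- `v` is a (periodic) viscosity solution in `𝕋ᴺ` of
`lam v(y) - a(y) ∫ (increment of v at y) dμ - f₀(y) = 0`. -/
def SolvesErgodic {M N : ℕ} (form : Form) (β : E M → E N) (μ : Measure (E M))
    (a f₀ : E N → ℝ) (lam : ℝ) (v : E N → ℝ) : Prop :=
  Periodic v ∧
  IsViscositySubsolution form β μ a (fun y r => lam * r - f₀ y) 0 v ∧
  IsViscositySupersolution form β μ a (fun y r => lam * r - f₀ y) 0 v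

/-- For every `δ > 0` there are a (periodic) viscosity subsolution `w` and a (periodic) viscosity
supersolution `w'` in `𝕋ᴺ` of, respectively,
`d - a(y) ∫ (increment of w at y) dμ - f₀(y) ≤ δ` and
`d - a(y) ∫ (increment of w' at y) dμ - f₀(y) ≥ -δ`. -/
def SolvesCellApproximately {M N : ℕ} (form : Form) (β : E M → E N) (μ : Measure (E M))
    (a f₀ : E N → ℝ) (d : ℝ) : Prop :=
  ∀ δ : ℝ, 0 < δ →
    (∃ w : E N → ℝ, Periodic w ∧
      IsViscositySubsolution form β μ a (fun y _ => d - f₀ y) δ w) ∧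
    (∃ w' : E N → ℝ, Periodic w' ∧
      IsViscositySupersolution form β μ a (fun y _ => d - f₀ y) (-δ) w')

end LevyErgodic

/-!
The Lévy integral commutes with translations: the law of the jumps `β z` does not depend on the
position, and the position enters the equation only through the factor `a` and the source `f₀`.
Hence, in a doubling of variables with a penalization `K * ‖x - y‖ ^ 2`, the increments at the two
points of a maximum have the same gradient term and are ordered, and the nonlocal terms disappear altogether
(`IsViscositySubsolution.le_of_penalized`): only the values of `F`, weighted by `a`, are compared.
Two facts follow.

* Comparison for the cell problem (`cell_comparison`): the constant of an approximate subsolution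
  exceeds that of an approximate supersolution at most by the sum of the two errors. This gives the
  uniqueness of `d`.
* Equicontinuity (`exists_equicontinuity`): comparing `v_lam` with itself, the Hölder moduli of `a`
  and `f₀` bound the modulus of continuity of `lam * v_lam` uniformly in `lam`. Any bound
  `A * t ^ θ₁ + B * t ^ θ₂` lies below `η + K * t ^ 2` for a suitable `K`, so quadratic test
  functions are enough.

The Lévy integral of `lam * v_lam` is `O(lam)` from below wherever a quadratic test function touches
from above. A quantitative strong maximum principle (`asymptotically_max_of_jump`) turns this into
the statement that asymptotic maximality of `lam * v_lam` as `lam → 0` is inherited by the points to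
which jumps lead, and condition (B) spreads it over the torus. With the equicontinuity and the
compactness of the torus, the oscillation of `lam * v_lam` tends to `0`
(`eventually_oscillation_le`). Once it is small, `v_lam` is both an approximate subsolution and an
approximate supersolution of the cell problem with the constant `lam * v_lam 0`; by comparison these
constants form a Cauchy family as `lam → 0`, and their limit is `d`.
-/

namespace LevyErgodic

/-! ### Periodic functions and compactness -/

lemma exists_add_intVec_mem_closedBall {N : ℕ} (y : E N) :
    ∃ k : Fin N → ℤ, y + intVec k ∈ Metric.closedBall (0 : E N) (√N) := by
  refine ⟨fun i => -⌊y i⌋, ?_⟩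
  rw [mem_closedBall_zero_iff, EuclideanSpace.norm_eq]
  refine Real.sqrt_le_sqrt ?_
  have h : ∀ i ∈ (Finset.univ : Finset (Fin N)),
      ‖(y + intVec fun i => -⌊y i⌋) i‖ ^ 2 ≤ (1 : ℝ) := by
    intro i _
    have : (y + intVec fun i => -⌊y i⌋) i = Int.fract (y i) := by
      simp [intVec, Int.fract, sub_eq_add_neg]
    rw [this, Real.norm_eq_abs, abs_of_nonneg (Int.fract_nonneg _)]
    have := Int.fract_nonneg (y i)
    have := (Int.fract_lt_one (y i)).le
    nlinarith
  simpa using Finset.sum_le_sum h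

lemma Periodic.neg {N : ℕ} {u : E N → ℝ} (hu : Periodic u) : Periodic fun y => -u y :=
  fun k y => by simp [hu k y]

lemma _root_.LowerSemicontinuous.upperSemicontinuous_neg {X : Type*} [TopologicalSpace X]
    {u : X → ℝ} (hu : LowerSemicontinuous u) : UpperSemicontinuous fun y => -u y :=
  continuous_neg.comp_lowerSemicontinuous_antitone hu fun _ _ h => neg_le_neg h

lemma Periodic.exists_max {N : ℕ} {u : E N → ℝ} (hu : Periodic u) (h : UpperSemicontinuous u) :
    ∃ x ∈ Metric.closedBall (0 : E N) (√N), ∀ y, u y ≤ u x := by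
  obtain ⟨x, hx, hmax⟩ := UpperSemicontinuousOn.exists_isMaxOn
    (Metric.nonempty_closedBall.2 (Real.sqrt_nonneg _)) (isCompact_closedBall (0 : E N) (√N))
    (h.upperSemicontinuousOn _)
  refine ⟨x, hx, fun y => ?_⟩
  obtain ⟨k, hk⟩ := exists_add_intVec_mem_closedBall y
  rw [← hu k y]
  exact hmax hk

lemma Periodic.exists_min {N : ℕ} {u : E N → ℝ} (hu : Periodic u) (h : LowerSemicontinuous u) :
    ∃ x ∈ Metric.closedBall (0 : E N) (√N), ∀ y, u x ≤ u y := by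
  obtain ⟨x, hx, hmax⟩ := hu.neg.exists_max h.upperSemicontinuous_neg
  exact ⟨x, hx, fun y => neg_le_neg_iff.1 (hmax y)⟩

lemma Periodic.exists_abs_le {N : ℕ} {f : E N → ℝ} (hf : Periodic f) {L θ : ℝ} (hL : 0 < L)
    (hθ : 0 < θ) (h : ∀ y y', |f y - f y'| ≤ L * ‖y - y'‖ ^ θ) : ∃ C, 0 < C ∧ ∀ y, |f y| ≤ C := by
  refine ⟨|f 0| + L * √N ^ θ + 1, by positivity, fun y => ?_⟩
  obtain ⟨k, hk⟩ := exists_add_intVec_mem_closedBall y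
  rw [mem_closedBall_zero_iff] at hk
  have h1 := h (y + intVec k) 0
  rw [hf k y, sub_zero] at h1
  have h2 : ‖y + intVec k‖ ^ θ ≤ √N ^ θ := Real.rpow_le_rpow (norm_nonneg _) hk hθ.le
  have h3 := abs_sub_abs_le_abs_sub (f y) (f 0)
  have h4 := mul_le_mul_of_nonneg_left h2 hL.le
  linarith

/-- Doubling of variables: the quadratically penalized difference of a periodic upper semicontinuous
and a periodic lower semicontinuous function attains its maximum. The penalized difference is
invariant under a common integral translation of the two points, so one of them may be confined to
a compact set, and the penalization confines the other. -/
lemma Periodic.exists_max_penalized {N : ℕ} {u w : E N → ℝ} (hu : Periodic u) (hw : Periodic w)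
    (hu' : UpperSemicontinuous u) (hw' : LowerSemicontinuous w) {K : ℝ} (hK : 0 < K) :
    ∃ x y, ∀ x' y', u x' - w y' - K * ‖x' - y'‖ ^ 2 ≤ u x - w y - K * ‖x - y‖ ^ 2 := by
  obtain ⟨xu, -, hxu⟩ := hu.exists_max hu'
  obtain ⟨xw, -, hxw⟩ := hw.exists_min hw'
  set T : ℝ := (u xu - w xw - (u 0 - w 0)) / K with hT
  have hT0 : 0 ≤ T := div_nonneg (by linarith [hxu 0, hxw 0]) hK.le
  set R : ℝ := √N
  have hR : 0 ≤ R := Real.sqrt_nonneg _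
  set Q : Set (E N × E N) := Metric.closedBall 0 R ×ˢ Metric.closedBall 0 (R + √T)
  have h0 : ((0 : E N), (0 : E N)) ∈ Q :=
    ⟨Metric.mem_closedBall_self hR,
      Metric.mem_closedBall_self (add_nonneg hR (Real.sqrt_nonneg _))⟩
  have husc : UpperSemicontinuous
      fun p : E N × E N => u p.1 + -w p.2 + -(K * ‖p.1 - p.2‖ ^ 2) := by
    refine ((hu'.comp continuous_fst).add (hw'.upperSemicontinuous_neg.comp continuous_snd)).add ?_
    exact Continuous.upperSemicontinuous (by fun_prop)
  obtain ⟨⟨x, y⟩, -, hmax⟩ := UpperSemicontinuousOn.exists_isMaxOn ⟨_, h0⟩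
    ((isCompact_closedBall _ _).prod (isCompact_closedBall _ _)) (husc.upperSemicontinuousOn Q)
  refine ⟨x, y, fun x' y' => ?_⟩
  obtain ⟨k, hk⟩ := exists_add_intVec_mem_closedBall x'
  rw [← hu k x', ← hw k y', ← add_sub_add_right_eq_sub x' y' (intVec k)]
  generalize x' + intVec k = x' at hk
  generalize y' + intVec k = y'
  by_cases hy : ‖x' - y'‖ ≤ √T
  · have hmem : (x', y') ∈ Q := by
      refine ⟨hk, ?_⟩
      rw [mem_closedBall_zero_iff] at hk ⊢
      have : ‖y'‖ ≤ ‖x'‖ + ‖x' - y'‖ := norm_le_norm_add_norm_sub _ _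
      exact this.trans (add_le_add hk hy)
    have := hmax hmem
    simp only [Set.mem_ofPred_eq] at this
    linarith
  · have h1 : T < ‖x' - y'‖ ^ 2 := Real.lt_sq_of_sqrt_lt (not_le.1 hy)
    have h2 : K * T = u xu - w xw - (u 0 - w 0) := by rw [hT]; field_simp
    have h3 := mul_lt_mul_of_pos_left h1 hK
    have h4 := hmax h0
    simp only [Set.mem_ofPred_eq, sub_zero, norm_zero] at h4
    have h5 := hxu x'
    have h6 := hxw y'
    nlinarith

/-! ### Quadratic test functions -/

lemma gradient_quadratic {N : ℕ} (c K : ℝ) (p x : E N) :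
    gradient (fun ξ : E N => c + K * ‖ξ - p‖ ^ 2) x = (2 * K) • (x - p) := by
  refine HasGradientAt.gradient ?_
  rw [hasGradientAt_iff_hasFDerivAt]
  have h := (((hasFDerivAt_id x).sub_const p).norm_sq.const_mul K).const_add c
  refine h.congr_fderiv ?_
  ext ξ
  simp
  ring

lemma contDiff_quadratic {N : ℕ} (c K : ℝ) (p : E N) :
    ContDiff ℝ 2 fun ξ : E N => c + K * ‖ξ - p‖ ^ 2 :=
  contDiff_const.add (contDiff_const.mul ((contDiff_id.sub contDiff_const).norm_sq ℝ))

section Viscosity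

variable {form : Form} {M N : ℕ} {β : E M → E N} {μ : Measure (E M)} {a : E N → ℝ}
  {F G : E N → ℝ → ℝ} {c c' : ℝ} {u w : E N → ℝ}

lemma IsViscositySubsolution.of_quadratic (hu : IsViscositySubsolution form β μ a F c u) {K : ℝ}
    {p x : E N} (h : ∀ ξ, u ξ - K * ‖ξ - p‖ ^ 2 ≤ u x - K * ‖x - p‖ ^ 2) :
    Integrable (increment form β u x ((2 * K) • (x - p))) μ ∧
      F x (u x) - a x * ∫ z, increment form β u x ((2 * K) • (x - p)) z ∂μ ≤ c := by
  have := hu.2 x _ (contDiff_quadratic (u x - K * ‖x - p‖ ^ 2) K p) (by ring)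
    fun ξ => by linarith [h ξ]
  rwa [gradient_quadratic] at this

lemma IsViscositySupersolution.of_quadratic (hu : IsViscositySupersolution form β μ a F c u)
    {K : ℝ} {p x : E N} (h : ∀ ξ, u x - K * ‖x - p‖ ^ 2 ≤ u ξ - K * ‖ξ - p‖ ^ 2) :
    Integrable (increment form β u x ((2 * K) • (x - p))) μ ∧
      c ≤ F x (u x) - a x * ∫ z, increment form β u x ((2 * K) • (x - p)) z ∂μ := by
  have := hu.2 x _ (contDiff_quadratic (u x - K * ‖x - p‖ ^ 2) K p) (by ring)
    fun ξ => by linarith [h ξ]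
  rwa [gradient_quadratic] at this

/-- At a maximum of the penalized difference the two test functions have the same gradient, and,
since the jumps `β z` do not depend on the position, the increments of `u` and `w` are ordered. -/
lemma increment_le_increment {K : ℝ} {x y : E N}
    (h : ∀ x' y', u x' - w y' - K * ‖x' - y'‖ ^ 2 ≤ u x - w y - K * ‖x - y‖ ^ 2) (p : E N)
    (z : E M) : increment form β u x p z ≤ increment form β w y p z := by
  have := h (x + β z) (y + β z)
  rw [add_sub_add_right_eq_sub] at this
  cases form <;> simp only [increment] <;> linarith

/-- The nonlocal terms drop out of the comparison of a subsolution and a supersolution at a maximum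
of their penalized difference. -/
lemma IsViscositySubsolution.le_of_penalized (hu : IsViscositySubsolution form β μ a F c u)
    (hw : IsViscositySupersolution form β μ a G c' w) (ha : ∀ y, 0 < a y) {K : ℝ} {x y : E N}
    (h : ∀ x' y', u x' - w y' - K * ‖x' - y'‖ ^ 2 ≤ u x - w y - K * ‖x - y‖ ^ 2) :
    (F x (u x) - c) * a y ≤ (G y (w y) - c') * a x := by
  obtain ⟨hi, h1⟩ := hu.of_quadratic (K := K) (p := y) (x := x) fun ξ => by linarith [h ξ y]
  obtain ⟨hi', h2⟩ := hw.of_quadratic (K := -K) (p := x) (x := y) fun ξ => by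
    have := h x ξ
    rw [norm_sub_rev x ξ, norm_sub_rev x y] at this
    linarith
  have hp : (2 * -K) • (y - x) = (2 * K) • (x - y) := by
    rw [mul_neg, neg_smul, ← smul_neg, neg_sub]
  rw [hp] at hi' h2
  have h3 := integral_mono hi hi' fun z => increment_le_increment h _ z
  have h4 : (F x (u x) - c) * a y
      ≤ a x * (∫ z, increment form β u x ((2 * K) • (x - y)) z ∂μ) * a y :=
    mul_le_mul_of_nonneg_right (by linarith) (ha y).le
  have h5 : a y * (∫ z, increment form β w y ((2 * K) • (x - y)) z ∂μ) * a x
      ≤ (G y (w y) - c') * a x :=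
    mul_le_mul_of_nonneg_right (by linarith) (ha x).le
  have h6 := mul_le_mul_of_nonneg_left h3 (mul_pos (ha x) (ha y)).le
  linarith

end Viscosity

/-! ### Comparison for the cell problem -/

lemma rpow_le_add_mul_sq {θ : ℝ} (hθ : θ ∈ Set.Ioc (0 : ℝ) 1) {η : ℝ} (hη : 0 < η) :
    ∃ K : ℝ, 0 < K ∧ ∀ t : ℝ, 0 ≤ t → t ^ θ ≤ η + K * t ^ 2 := by
  have ht0 : 0 < η ^ θ⁻¹ := Real.rpow_pos_of_pos hη _
  refine ⟨(η ^ θ⁻¹) ^ (θ - 2), Real.rpow_pos_of_pos ht0 _, fun t ht => ?_⟩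
  rcases le_or_gt t (η ^ θ⁻¹) with h | h
  · have : t ^ θ ≤ (η ^ θ⁻¹) ^ θ := Real.rpow_le_rpow ht h hθ.1.le
    rw [← Real.rpow_mul hη.le, inv_mul_cancel₀ hθ.1.ne', Real.rpow_one] at this
    have : 0 ≤ (η ^ θ⁻¹) ^ (θ - 2) * t ^ 2 := by positivity
    linarith
  · have htp : 0 < t := ht0.trans h
    have h1 : t ^ (θ - 2) ≤ (η ^ θ⁻¹) ^ (θ - 2) :=
      Real.rpow_le_rpow_of_nonpos ht0 h.le (by linarith [hθ.2])
    have h2 : t ^ θ = t ^ (θ - 2) * t ^ 2 := by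
      rw [← Real.rpow_natCast t 2, ← Real.rpow_add htp]
      congr 1
      push_cast
      ring
    rw [h2]
    have := mul_le_mul_of_nonneg_right h1 (sq_nonneg t)
    linarith

/-- The modulus of continuity that governs the doubling arguments, dominated by an arbitrarily small
constant plus a multiple of the square. -/
lemma exists_modulus_le {L θ₁ θ₂ : ℝ} (hL : 0 < L) (hθ₁ : θ₁ ∈ Set.Ioc (0 : ℝ) 1)
    (hθ₂ : θ₂ ∈ Set.Ioc (0 : ℝ) 1) {A : ℝ} (hA : 0 < A) {η : ℝ} (hη : 0 < η) :
    ∃ K : ℝ, 0 < K ∧ ∀ t : ℝ, 0 ≤ t → A * (L * t ^ θ₁) + L * t ^ θ₂ ≤ η + K * t ^ 2 := by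
  obtain ⟨K₁, hK₁, h₁⟩ := rpow_le_add_mul_sq hθ₁ (η := η / (2 * (A * L))) (by positivity)
  obtain ⟨K₂, hK₂, h₂⟩ := rpow_le_add_mul_sq hθ₂ (η := η / (2 * L)) (by positivity)
  refine ⟨A * L * K₁ + L * K₂, by positivity, fun t ht => ?_⟩
  have e1 := mul_le_mul_of_nonneg_left (h₁ t ht) (mul_pos hA hL).le
  have e2 := mul_le_mul_of_nonneg_left (h₂ t ht) hL.le
  have e3 : A * L * (η / (2 * (A * L)) + K₁ * t ^ 2) = η / 2 + A * L * K₁ * t ^ 2 := by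
    field_simp
  have e4 : L * (η / (2 * L) + K₂ * t ^ 2) = η / 2 + L * K₂ * t ^ 2 := by
    field_simp
  linarith

/-- Elementary consequence of the comparison of two frozen equations `(r - f₀ x) / a x ≤
(r' - f₀ y) / a y`. -/
lemma sub_le_of_mul_le {N : ℕ} {a f₀ : E N → ℝ} {a₀ C L θ₁ θ₂ : ℝ} (ha₀ : 0 < a₀)
    (ha : ∀ y, a₀ ≤ a y) (ha_holder : ∀ y y', |a y - a y'| ≤ L * ‖y - y'‖ ^ θ₁)
    (hf₀_holder : ∀ y y', |f₀ y - f₀ y'| ≤ L * ‖y - y'‖ ^ θ₂) {r r' : ℝ} {x y : E N}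
    (hC : |r' - f₀ y| ≤ C) (h : (r - f₀ x) * a y ≤ (r' - f₀ y) * a x) :
    r - r' ≤ C / a₀ * (L * ‖x - y‖ ^ θ₁) + L * ‖x - y‖ ^ θ₂ := by
  have hay : 0 < a y := ha₀.trans_le (ha y)
  have h1 : (r' - f₀ y) * (a x - a y) ≤ C * (L * ‖x - y‖ ^ θ₁) := by
    refine (le_abs_self _).trans ?_
    rw [abs_mul]
    exact mul_le_mul hC (ha_holder x y) (abs_nonneg _) ((abs_nonneg _).trans hC)
  have h2 : (f₀ x - f₀ y) ≤ L * ‖x - y‖ ^ θ₂ := (le_abs_self _).trans (hf₀_holder x y)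
  have h0 : 0 ≤ C * (L * ‖x - y‖ ^ θ₁) :=
    mul_nonneg ((abs_nonneg _).trans hC) ((abs_nonneg _).trans (ha_holder x y))
  have h3 : r - r' - (f₀ x - f₀ y) ≤ C * (L * ‖x - y‖ ^ θ₁) / a y := by
    rw [le_div_iff₀ hay]
    linarith
  have h4 : C * (L * ‖x - y‖ ^ θ₁) / a y ≤ C * (L * ‖x - y‖ ^ θ₁) / a₀ :=
    div_le_div_of_nonneg_left h0 ha₀ (ha y)
  have h5 : C * (L * ‖x - y‖ ^ θ₁) / a₀ = C / a₀ * (L * ‖x - y‖ ^ θ₁) := by ring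
  linarith

/-- Comparison for the cell problem: the constant of an approximate subsolution exceeds the constant
of an approximate supersolution at most by the sum of the errors. -/
lemma cell_comparison {form : Form} {M N : ℕ} {β : E M → E N} {μ : Measure (E M)}
    {a f₀ : E N → ℝ} {a₀ L θ₁ θ₂ : ℝ} (hf₀_per : Periodic f₀)
    (ha₀ : 0 < a₀) (hL : 0 < L) (hθ₁ : θ₁ ∈ Set.Ioc (0 : ℝ) 1) (hθ₂ : θ₂ ∈ Set.Ioc (0 : ℝ) 1)
    (ha : ∀ y, a₀ ≤ a y) (ha_holder : ∀ y y', |a y - a y'| ≤ L * ‖y - y'‖ ^ θ₁)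
    (hf₀_holder : ∀ y y', |f₀ y - f₀ y'| ≤ L * ‖y - y'‖ ^ θ₂) {d d' c c' : ℝ} {u w : E N → ℝ}
    (hu : Periodic u) (hw : Periodic w)
    (hu' : IsViscositySubsolution form β μ a (fun y _ => d - f₀ y) c u)
    (hw' : IsViscositySupersolution form β μ a (fun y _ => d' - f₀ y) (-c') w) :
    d ≤ d' + (c + c') := by
  obtain ⟨C₀, hC₀, hf₀⟩ := hf₀_per.exists_abs_le hL hθ₂.1 hf₀_holder
  obtain ⟨xu, -, hxu⟩ := hu.exists_max hu'.1
  obtain ⟨xw, -, hxw⟩ := hw.exists_min hw'.1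
  set T := u xu - w xw - (u 0 - w 0) with hT
  have hT0 : 0 ≤ T := by linarith [hxu 0, hxw 0]
  refine le_of_forall_pos_le_add fun η hη => ?_
  obtain ⟨K, hK, hmod⟩ := exists_modulus_le hL hθ₁ hθ₂
    (A := (|d' + c'| + C₀) / a₀) (by positivity) (η := η / 2) (by positivity)
  -- with this penalization, `K * ‖x - y‖ ^ 2 ≤ η / 2` at the maximum
  set n : ℝ := K * (T + 1) / (η / 2) with hn
  have hn0 : 0 < n := by positivity
  obtain ⟨x, y, hxy⟩ := hu.exists_max_penalized hw hu'.1 hw'.1 hn0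
  have h1 := hu'.le_of_penalized hw' (fun y => ha₀.trans_le (ha y)) hxy
  have h2 := sub_le_of_mul_le (r := d - c) (r' := d' + c') (x := x) (y := y)
    (C := |d' + c'| + C₀) ha₀ ha ha_holder hf₀_holder
    ((abs_sub _ _).trans (by linarith [hf₀ y])) (by linarith)
  have h3 := hmod _ (norm_nonneg (x - y))
  have h4 : n * ‖x - y‖ ^ 2 ≤ T := by
    have := hxy 0 0
    simp only [sub_self, norm_zero] at this
    linarith [hxu x, hxw y]
  have h5 : K * ‖x - y‖ ^ 2 ≤ η / 2 := by
    have e : n * ‖x - y‖ ^ 2 = (K * ‖x - y‖ ^ 2) * (T + 1) / (η / 2) := by rw [hn]; ring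
    rw [e, div_le_iff₀ (by positivity)] at h4
    by_contra hcon
    push Not at hcon
    have := mul_lt_mul_of_pos_right hcon (by linarith : 0 < T + 1)
    nlinarith
  linarith

/-! ### Uniform bounds and equicontinuity -/

section Solutions

variable {form : Form} {M N : ℕ} {β : E M → E N} {μ : Measure (E M)} {a f₀ : E N → ℝ}
  {a₀ L θ₁ θ₂ lam C₀ : ℝ} {v : E N → ℝ}

lemma increment_zero (u : E N → ℝ) (y : E N) (z : E M) :
    increment form β u y 0 z = u (y + β z) - u y := by
  cases form <;> simp [increment]

/-- Maximum principle: constants are admissible test functions at the extrema of `v`. -/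
lemma SolvesErgodic.abs_mul_le (hv : SolvesErgodic form β μ a f₀ lam v) (hlam : 0 < lam)
    (ha : ∀ y, 0 < a y) (hf₀ : ∀ y, |f₀ y| ≤ C₀) (y : E N) : |lam * v y| ≤ C₀ := by
  obtain ⟨hper, hsub, hsup⟩ := hv
  obtain ⟨x, -, hx⟩ := hper.exists_max hsub.1
  obtain ⟨x', -, hx'⟩ := hper.exists_min hsup.1
  obtain ⟨-, h1⟩ := hsub.of_quadratic (K := 0) (p := x) (x := x) fun ξ => by simpa using hx ξ
  obtain ⟨-, h2⟩ := hsup.of_quadratic (K := 0) (p := x') (x := x') fun ξ => by simpa using hx' ξ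
  rw [sub_self, smul_zero] at h1 h2
  have h3 : ∫ z, increment form β v x 0 z ∂μ ≤ 0 :=
    integral_nonpos fun z => by simpa [increment_zero] using hx _
  have h4 : 0 ≤ ∫ z, increment form β v x' 0 z ∂μ :=
    integral_nonneg fun z => by simpa [increment_zero] using hx' _
  have h5 := mul_nonpos_of_nonneg_of_nonpos (ha x).le h3
  have h6 := mul_nonneg (ha x').le h4
  have h7 := abs_le.1 (hf₀ x)
  have h8 := abs_le.1 (hf₀ x')
  have h9 := mul_le_mul_of_nonneg_left (hx y) hlam.le
  have h10 := mul_le_mul_of_nonneg_left (hx' y) hlam.le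
  exact abs_le.2 ⟨by linarith, by linarith⟩

/-- Equicontinuity of the functions `lam * v_lam`: in the comparison of `v_lam` with itself at the
maximum of the penalized difference the nonlocal terms cancel, and what remains bounds the
oscillation of `lam * v_lam` by the modulus of the coefficients, uniformly in `lam`. -/
lemma exists_equicontinuity (hf₀_per : Periodic f₀)
    (ha₀ : 0 < a₀) (hL : 0 < L) (hθ₁ : θ₁ ∈ Set.Ioc (0 : ℝ) 1) (hθ₂ : θ₂ ∈ Set.Ioc (0 : ℝ) 1)
    (ha : ∀ y, a₀ ≤ a y) (ha_holder : ∀ y y', |a y - a y'| ≤ L * ‖y - y'‖ ^ θ₁)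
    (hf₀_holder : ∀ y y', |f₀ y - f₀ y'| ≤ L * ‖y - y'‖ ^ θ₂) {v : ℝ → E N → ℝ}
    (hv : ∀ lam : ℝ, 0 < lam → SolvesErgodic form β μ a f₀ lam (v lam)) {η : ℝ} (hη : 0 < η) :
    ∃ K : ℝ, 0 < K ∧ ∀ lam : ℝ, 0 < lam → ∀ x y,
      lam * v lam x - lam * v lam y ≤ η + K * ‖x - y‖ ^ 2 := by
  obtain ⟨C₀, hC₀, hf₀⟩ := hf₀_per.exists_abs_le hL hθ₂.1 hf₀_holder
  obtain ⟨K, hK, hmod⟩ := exists_modulus_le hL hθ₁ hθ₂ (A := (C₀ + C₀) / a₀) (by positivity) hη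
  refine ⟨K, hK, fun lam hlam x' y' => ?_⟩
  have ha' : ∀ y, 0 < a y := fun y => ha₀.trans_le (ha y)
  obtain ⟨hper, hsub, hsup⟩ := hv lam hlam
  obtain ⟨x, y, hxy⟩ := hper.exists_max_penalized hper hsub.1 hsup.1 (div_pos hK hlam)
  have h1 := hsub.le_of_penalized hsup ha' hxy
  simp only [sub_zero] at h1
  have h2 := sub_le_of_mul_le ha₀ ha ha_holder hf₀_holder
    ((abs_sub _ _).trans (add_le_add ((hv lam hlam).abs_mul_le hlam ha' hf₀ y) (hf₀ y))) h1
  have h3 := hmod _ (norm_nonneg (x - y))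
  have h4 := mul_le_mul_of_nonneg_left (hxy x' y') hlam.le
  have e : ∀ t : ℝ, lam * (K / lam * t) = K * t := fun t => by field_simp
  rw [mul_sub, mul_sub, mul_sub, mul_sub, e, e] at h4
  linarith

end Solutions

/-! ### Propagation of maxima along the jumps -/

/-- The function `|z|^γ` near the origin and `|z|^(γ-1)` away from it, which the standing
integrability condition on the Lévy measure makes integrable. -/
noncomputable def levyWeight {M : ℕ} (γ : ℕ) (z : E M) : ℝ :=
  if ‖z‖ < 1 then ‖z‖ ^ γ else ‖z‖ ^ (γ - 1)

lemma levyWeight_nonneg {M : ℕ} (γ : ℕ) (z : E M) : 0 ≤ levyWeight γ z := by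
  unfold levyWeight
  split_ifs <;> positivity

lemma LevyIntegrable.integrable_levyWeight {M γ : ℕ} {μ : Measure (E M)}
    (h : LevyIntegrable γ μ) : Integrable (levyWeight γ) μ := by
  have hs : MeasurableSet {z : E M | ‖z‖ < 1} := measurableSet_lt measurable_norm measurable_const
  have hc : {z : E M | ‖z‖ < 1}ᶜ = {z : E M | 1 ≤ ‖z‖} := by
    ext z
    simp
  have key : ∀ (n : ℕ) (s : Set (E M)), ∫⁻ z in s, ‖z‖ₑ ^ n ∂μ < ∞ →
      IntegrableOn (fun z : E M => ‖z‖ ^ n) s μ := fun n s hn => by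
    refine ⟨by fun_prop, ?_⟩
    rw [hasFiniteIntegral_iff_enorm]
    simpa [enorm_pow] using hn
  have h1 := key _ _ (lt_of_le_of_lt le_self_add h)
  have h2 := key _ _ (lt_of_le_of_lt le_add_self h)
  rw [← hc] at h2
  have := Integrable.piecewise hs h1 h2
  refine this.congr (Eventually.of_forall fun z => ?_)
  simp [Set.piecewise, levyWeight]

/-- Increments at a maximum point `x` of `u - κ |· - y|²`, where `u y` falls short of the upper
bound `S` of `u` by at most `s`. The second bound is the gain from the jumps that lead to points where `u`
is far below `S`. -/
lemma increment_le_levyWeight {form : Form} {M N : ℕ} {β : E M → E N} {B : ℝ} (hB : 0 ≤ B)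
    (hβ : ∀ z, ‖β z‖ ≤ B * ‖z‖) {u : E N → ℝ} {S s κ : ℝ} (hs : 0 ≤ s) (hκ : 0 ≤ κ)
    {x y : E N} (hxy : ‖x - y‖ ≤ 1) (hS : ∀ ξ, u ξ ≤ S) (hy : S - s ≤ u y)
    (hx : ∀ ξ, u ξ - κ * ‖ξ - y‖ ^ 2 ≤ u x - κ * ‖x - y‖ ^ 2) (z : E M) :
    increment form β u x ((2 * κ) • (x - y)) z
        ≤ (κ * (B ^ 2 + 2 * B) + s) * levyWeight form.order z ∧
      increment form β u x ((2 * κ) • (x - y)) z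
        ≤ (κ * (B ^ 2 + 2 * B) + s) * levyWeight form.order z + s - (S - u (x + β z)) := by
  set h := β z with hh
  set i : ℝ := inner ℝ (x - y) h with hi
  have hexp : ‖x + h - y‖ ^ 2 = ‖x - y‖ ^ 2 + 2 * i + ‖h‖ ^ 2 := by
    rw [add_sub_right_comm, norm_add_sq_real]
  have hA : u (x + h) - u x ≤ κ * (2 * i + ‖h‖ ^ 2) := by
    have := hx (x + h)
    rw [hexp] at this
    linarith
  have hux : S - s + κ * ‖x - y‖ ^ 2 ≤ u x := by
    have := hx y
    simp only [sub_self, norm_zero] at this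
    linarith
  have hx2 : 0 ≤ κ * ‖x - y‖ ^ 2 := by positivity
  have hih : |i| ≤ B * ‖z‖ := by
    refine (abs_real_inner_le_norm _ _).trans ?_
    calc ‖x - y‖ * ‖h‖ ≤ 1 * ‖h‖ := mul_le_mul_of_nonneg_right hxy (norm_nonneg _)
      _ ≤ B * ‖z‖ := by rw [one_mul]; exact hβ z
  obtain ⟨hi1, hi2⟩ := abs_le.1 hih
  have hκi1 := mul_le_mul_of_nonneg_left hi1 hκ
  have hκi2 := mul_le_mul_of_nonneg_left hi2 hκ
  have hh2 : ‖h‖ ^ 2 ≤ B ^ 2 * ‖z‖ ^ 2 := by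
    rw [← mul_pow]
    exact pow_le_pow_left₀ (norm_nonneg _) (hβ z) 2
  have hκh2 := mul_le_mul_of_nonneg_left hh2 hκ
  have hsq : 0 ≤ κ * (‖x - y‖ ^ 2 + 2 * i + ‖h‖ ^ 2) := by
    rw [← hexp]
    positivity
  have hz := norm_nonneg z
  have hSx := hS (x + h)
  have hinner : inner ℝ ((2 * κ) • (x - y)) h = 2 * κ * i := by
    rw [real_inner_smul_left]
  have p1 : 0 ≤ κ * B * ‖z‖ := by positivity
  have p2 : 0 ≤ κ * B * ‖z‖ ^ 2 := by positivity
  have p3 : 0 ≤ κ * B ^ 2 * ‖z‖ := by positivity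
  have p4 : 0 ≤ s * ‖z‖ ^ 2 := by positivity
  have p5 : 0 ≤ s * ‖z‖ := by positivity
  have p6 : 0 ≤ κ * B := by positivity
  have p7 : 0 ≤ κ * B ^ 2 := by positivity
  by_cases hz1 : ‖z‖ < 1
  · have hzz : ‖z‖ ^ 2 ≤ ‖z‖ := by nlinarith
    have p8 := mul_le_mul_of_nonneg_left hzz p7
    cases form
    · simp only [increment, Form.order, levyWeight, hz1, if_true, ← hh, hinner]
      constructor <;> linarith
    · simp only [increment, Form.order, levyWeight, hz1, if_true, ← hh, pow_one]
      constructor <;> linarith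
  · have hz2 : 1 ≤ ‖z‖ := not_lt.1 hz1
    have p8 := mul_le_mul_of_nonneg_left hz2 hs
    cases form
    · simp only [increment, Form.order, levyWeight, hz1, if_false, ← hh, hinner,
        Nat.add_one_sub_one, pow_one]
      constructor <;> linarith
    · simp only [increment, Form.order, levyWeight, hz1, if_false, ← hh, Nat.sub_self, pow_zero]
      constructor <;> linarith

lemma integral_le_of_le_on {Ω : Type*} [MeasurableSpace Ω] {μ : Measure Ω} {f g : Ω → ℝ}
    (hf : Integrable f μ) (hg : Integrable g μ) {J : Set Ω} (hJ : MeasurableSet J)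
    (hJ' : μ J < ∞) {c : ℝ} (h : ∀ z, f z ≤ g z) (h' : ∀ z ∈ J, f z ≤ g z - c) :
    ∫ z, f z ∂μ ≤ ∫ z, g z ∂μ - c * μ.real J := by
  have hi : Integrable (J.indicator fun _ => c) μ :=
    (integrable_indicator_iff hJ).2 (integrableOn_const hJ'.ne)
  have e : ∫ z, J.indicator (fun _ => c) z ∂μ = c * μ.real J := by
    rw [integral_indicator_const _ hJ, smul_eq_mul, mul_comm]
  rw [← e, ← integral_sub hg hi]
  refine integral_mono hf (hg.sub hi) fun z => ?_
  by_cases hz : z ∈ J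
  · simpa [hz] using h' z hz
  · simpa [hz] using h z

lemma exists_max_sub_quadratic {N : ℕ} {u : E N → ℝ} (hu : UpperSemicontinuous u) {S s κ r : ℝ}
    (hr : 0 ≤ r) (hκ : 0 ≤ κ) (hs : s ≤ κ * r ^ 2) {y : E N} (hS : ∀ ξ, u ξ ≤ S)
    (hy : S - s ≤ u y) :
    ∃ x, ‖x - y‖ ≤ r ∧ ∀ ξ, u ξ - κ * ‖ξ - y‖ ^ 2 ≤ u x - κ * ‖x - y‖ ^ 2 := by
  have husc : UpperSemicontinuous fun ξ => u ξ + -(κ * ‖ξ - y‖ ^ 2) :=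
    hu.add (Continuous.upperSemicontinuous (by fun_prop))
  obtain ⟨x, hx, hmax⟩ := UpperSemicontinuousOn.exists_isMaxOn
    (Metric.nonempty_closedBall.2 hr) (isCompact_closedBall y r) (husc.upperSemicontinuousOn _)
  refine ⟨x, by rwa [← dist_eq_norm], fun ξ => ?_⟩
  by_cases hξ : ‖ξ - y‖ ≤ r
  · have : ξ ∈ Metric.closedBall y r := by rwa [Metric.mem_closedBall, dist_eq_norm]
    have := hmax this
    simp only [Set.mem_ofPred_eq] at this
    linarith
  · have h1 := hmax (Metric.mem_closedBall_self hr)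
    simp only [Set.mem_ofPred_eq, sub_self, norm_zero] at h1
    have h2 : r ^ 2 ≤ ‖ξ - y‖ ^ 2 := pow_le_pow_left₀ hr (not_le.1 hξ).le 2
    have h3 := mul_le_mul_of_nonneg_left h2 hκ
    linarith [hS ξ]

/-- Quantitative strong maximum principle, one step of a chain: along any filter on which `lam → 0`,
if `lam * v_lam` is asymptotically maximal at `y`, then it is so at every `y'` into every
neighbourhood of which the jumps from `y` lead with positive measure. Otherwise these jumps would
contribute to the Lévy integral a negative amount bounded away from zero, whereas the equation
bounds this integral, multiplied by `lam`, from below by a multiple of `lam`. -/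
lemma asymptotically_max_of_jump {form : Form} {M N : ℕ} {β : E M → E N} {μ : Measure (E M)}
    [SigmaFinite μ] {a f₀ : E N → ℝ} {a₀ B C₀ : ℝ} (hB : 0 ≤ B) (hβ : ∀ z, ‖β z‖ ≤ B * ‖z‖)
    (hμ : LevyIntegrable form.order μ) (ha₀ : 0 < a₀) (ha : ∀ y, a₀ ≤ a y) (hC₀ : 0 < C₀)
    (hf₀ : ∀ y, |f₀ y| ≤ C₀) {v : ℝ → E N → ℝ}
    (hv : ∀ lam : ℝ, 0 < lam → SolvesErgodic form β μ a f₀ lam (v lam))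
    (hequi : ∀ η : ℝ, 0 < η → ∃ K : ℝ, 0 < K ∧ ∀ lam : ℝ, 0 < lam → ∀ x y,
      lam * v lam x - lam * v lam y ≤ η + K * ‖x - y‖ ^ 2)
    {l : Filter ℝ} (hl : l ≤ 𝓝[>] 0) {S : ℝ → ℝ}
    (hS : ∀ lam : ℝ, 0 < lam → ∀ y, lam * v lam y ≤ S lam) {y y' : E N}
    (hjump : ∀ r : ℝ, 0 < r → ∃ J : Set (E M), MeasurableSet J ∧
      (∀ z ∈ J, y + β z ∈ torusBall y' r) ∧ 0 < μ J)
    (hy : ∀ e : ℝ, 0 < e → ∀ᶠ lam in l, S lam - lam * v lam y ≤ e) :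
    ∀ e : ℝ, 0 < e → ∀ᶠ lam in l, S lam - lam * v lam y' ≤ e := by
  intro e he
  obtain ⟨K, hK, hequi⟩ := hequi (e / 4) (by positivity)
  set r : ℝ := min 1 (e / (16 * K)) with hr
  have hr0 : 0 < r := lt_min one_pos (by positivity)
  have hr1 : r ≤ 1 := min_le_left _ _
  have hKr : K * (2 * r) ^ 2 ≤ e / 4 := by
    have h1 : r * (16 * K) ≤ e := (le_div_iff₀ (by positivity)).1 (min_le_right _ _)
    have h2 : K * r * r ≤ K * r * 1 := mul_le_mul_of_nonneg_left hr1 (by positivity)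
    linarith
  obtain ⟨J₀, hJ₀m, hJ₀, hJ₀pos⟩ := hjump r hr0
  obtain ⟨J, hJm, hJJ₀, hJpos, hJfin⟩ := Measure.exists_subset_measure_lt_top hJ₀m hJ₀pos
  set m : ℝ := μ.real J
  have hm : 0 < m := ENNReal.toReal_pos hJpos.ne' hJfin.ne
  set W : ℝ := ∫ z, levyWeight form.order z ∂μ with hW
  have hW0 : 0 ≤ W := integral_nonneg fun z => levyWeight_nonneg _ z
  set κ : ℝ := e * m / (16 * ((B ^ 2 + 2 * B + 1) * (W + 1))) with hκ
  have hD : 0 < (B ^ 2 + 2 * B + 1) * (W + 1) := by positivity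
  have hκ0 : 0 < κ := by positivity
  set s : ℝ := min (κ * r ^ 2) (e / 4) with hs
  have hs0 : 0 < s := lt_min (by positivity) (by positivity)
  set τ : ℝ := κ * (B ^ 2 + 2 * B) + s with hτ
  have hτW : τ * W ≤ e * m / 16 := by
    have h1 : s ≤ κ := by
      have : κ * r ^ 2 ≤ κ * 1 := mul_le_mul_of_nonneg_left (pow_le_one₀ hr0.le hr1) hκ0.le
      linarith [min_le_left (κ * r ^ 2) (e / 4)]
    have h2 : τ * W ≤ (κ * (B ^ 2 + 2 * B + 1)) * (W + 1) :=
      mul_le_mul (by linarith) (by linarith) hW0 (by positivity)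
    have h3 : (κ * (B ^ 2 + 2 * B + 1)) * (W + 1) = e * m / 16 := by
      rw [hκ]
      field_simp
    linarith
  have hev : ∀ᶠ lam : ℝ in l, lam * ((C₀ + C₀) / a₀) < e * m / 8 := by
    have h1 : Tendsto (fun lam : ℝ => lam * ((C₀ + C₀) / a₀)) (𝓝[>] 0) (𝓝 0) := by
      have : Tendsto (fun lam : ℝ => lam * ((C₀ + C₀) / a₀)) (𝓝 0) (𝓝 (0 * ((C₀ + C₀) / a₀))) :=
        tendsto_id.mul_const _
      rw [zero_mul] at this
      exact this.mono_left nhdsWithin_le_nhds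
    exact hl (h1.eventually_lt_const (by positivity))
  filter_upwards [hy s hs0, hev, hl self_mem_nhdsWithin] with lam h1 h2 h3
  have hlam : 0 < lam := h3
  by_contra hcon
  push Not at hcon
  obtain ⟨hper, hsub, -⟩ := hv lam hlam
  -- the equation is not rescaled: `S`, `s` and `κ` are divided by `lam` instead
  have hS' : ∀ ξ, v lam ξ ≤ S lam / lam := fun ξ => by
    rw [le_div_iff₀ hlam, mul_comm]
    exact hS lam hlam ξ
  have hy' : S lam / lam - s / lam ≤ v lam y := by
    rw [← sub_div, div_le_iff₀ hlam]
    linarith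
  have hκl : 0 ≤ κ / lam := by positivity
  obtain ⟨x, hxr, hx⟩ := exists_max_sub_quadratic hsub.1 hr0.le hκl
    (by rw [div_mul_eq_mul_div]; exact div_le_div_of_nonneg_right (min_le_left _ _) hlam.le) hS' hy'
  obtain ⟨hint, hineq⟩ := hsub.of_quadratic hx
  have hbd := increment_le_levyWeight (form := form) hB hβ (by positivity) hκl (hxr.trans hr1)
    hS' hy' hx
  have hτ' : κ / lam * (B ^ 2 + 2 * B) + s / lam = τ / lam := by rw [hτ]; ring
  rw [hτ'] at hbd
  have hJgain : ∀ z ∈ J, increment form β (v lam) x ((2 * (κ / lam)) • (x - y)) z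
      ≤ τ / lam * levyWeight form.order z - e / 4 / lam := by
    intro z hz
    refine (hbd z).2.trans ?_
    obtain ⟨k, hk⟩ := hJ₀ z (hJJ₀ hz)
    rw [Metric.mem_ball, dist_eq_norm] at hk
    have g1 := hequi lam hlam (x + β z + intVec k) y'
    rw [hper k] at g1
    have g2 : ‖x + β z + intVec k - y'‖ ≤ 2 * r := by
      have : x + β z + intVec k - y' = (x - y) + (y + β z + intVec k - y') := by abel
      rw [this]
      linarith [norm_add_le (x - y) (y + β z + intVec k - y')]
    have g3 : K * ‖x + β z + intVec k - y'‖ ^ 2 ≤ K * (2 * r) ^ 2 :=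
      mul_le_mul_of_nonneg_left (pow_le_pow_left₀ (norm_nonneg _) g2 2) hK.le
    have g4 : s ≤ e / 4 := min_le_right _ _
    have g5 : s / lam - (S lam / lam - v lam (x + β z)) ≤ -(e / 4 / lam) := by
      have : s / lam - (S lam / lam - v lam (x + β z)) + e / 4 / lam
          = (s + e / 4 - S lam + lam * v lam (x + β z)) / lam := by
        field_simp
        ring
      have h0 : (s + e / 4 - S lam + lam * v lam (x + β z)) / lam ≤ 0 :=
        div_nonpos_of_nonpos_of_nonneg (by linarith) hlam.le
      linarith
    linarith
  have hI := integral_le_of_le_on hint ((hμ.integrable_levyWeight).const_mul (τ / lam)) hJm hJfin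
    (fun z => (hbd z).1) hJgain
  rw [integral_const_mul, ← hW] at hI
  set I := ∫ z, increment form β (v lam) x ((2 * (κ / lam)) • (x - y)) z ∂μ
  have hax : 0 < a x := ha₀.trans_le (ha x)
  have hIlow : -((C₀ + C₀) / a₀) ≤ I := by
    have b1 := abs_le.1 ((hv lam hlam).abs_mul_le hlam (fun y => ha₀.trans_le (ha y)) hf₀ x)
    have b2 := abs_le.1 (hf₀ x)
    have b3 : -I * a x ≤ C₀ + C₀ := by linarith
    have b4 : -I ≤ (C₀ + C₀) / a x := (le_div_iff₀ hax).2 b3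
    have b5 : (C₀ + C₀) / a x ≤ (C₀ + C₀) / a₀ :=
      div_le_div_of_nonneg_left (by positivity) ha₀ (ha x)
    linarith
  have hfin := mul_le_mul_of_nonneg_left (hIlow.trans hI) hlam.le
  have e1 : lam * (τ / lam * W - e / 4 / lam * m) = τ * W - e * m / 4 := by
    field_simp
  have : 0 < e * m := by positivity
  change lam * -((C₀ + C₀) / a₀) ≤ lam * (τ / lam * W - e / 4 / lam * m) at hfin
  rw [e1] at hfin
  linarith

/-! ### Vanishing oscillation -/

/-- Asymptotic maximality propagates along the chains of condition (B), hence to every point. -/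
lemma asymptotically_max_of_controllable {M N : ℕ} {β : E M → E N} {μ : Measure (E M)}
    (hctrl : Controllable β μ) {P : E N → Prop}
    (hper : ∀ (k : Fin N → ℤ) (y : E N), P (y + intVec k) → P y)
    (hstep : ∀ y y' : E N, (∀ r : ℝ, 0 < r → ∃ J : Set (E M), MeasurableSet J ∧
      (∀ z ∈ J, y + β z ∈ torusBall y' r) ∧ 0 < μ J) → P y → P y') {y : E N} (hy : P y) (y' : E N) :
    P y' := by
  obtain ⟨m, p, h0, ⟨k, hk⟩, hJ⟩ := hctrl y y'
  have h : ∀ i, P (p i) := fun i => by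
    induction i using Fin.induction with
    | zero => rwa [h0]
    | succ i ih =>
      refine hstep _ _ (fun r hr => ?_) ih
      obtain ⟨J, hJm, -, hJ', hJpos⟩ := hJ (fun _ => r) (fun _ => hr) i
      exact ⟨J, hJm, hJ', hJpos⟩
  exact hper k y' (hk ▸ h _)

/-- The oscillation of `lam * v_lam` tends to `0`. Along an ultrafilter the points of maximum and of
minimum converge, so that `lam * v_lam` is asymptotically maximal at the limit of the former,
hence, by propagation, at the limit of the latter. -/
lemma eventually_oscillation_le {form : Form} {M N : ℕ} {β : E M → E N} {μ : Measure (E M)}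
    [SigmaFinite μ] {a f₀ : E N → ℝ} {a₀ B C₀ : ℝ} (hB : 0 ≤ B) (hβ : ∀ z, ‖β z‖ ≤ B * ‖z‖)
    (hμ : LevyIntegrable form.order μ) (hctrl : Controllable β μ)
    (ha₀ : 0 < a₀) (ha : ∀ y, a₀ ≤ a y) (hC₀ : 0 < C₀)
    (hf₀ : ∀ y, |f₀ y| ≤ C₀) {v : ℝ → E N → ℝ}
    (hv : ∀ lam : ℝ, 0 < lam → SolvesErgodic form β μ a f₀ lam (v lam))
    (hequi : ∀ η : ℝ, 0 < η → ∃ K : ℝ, 0 < K ∧ ∀ lam : ℝ, 0 < lam → ∀ x y,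
      lam * v lam x - lam * v lam y ≤ η + K * ‖x - y‖ ^ 2) {e : ℝ} (he : 0 < e) :
    ∀ᶠ lam in 𝓝[>] (0 : ℝ), ∀ x y, lam * v lam x - lam * v lam y ≤ e := by
  have hmax : ∀ lam : ℝ, ∃ x ∈ Metric.closedBall (0 : E N) (√N), 0 < lam →
      ∀ y, v lam y ≤ v lam x := fun lam => by
    by_cases h : 0 < lam
    · obtain ⟨x, hx, hx'⟩ := (hv lam h).1.exists_max (hv lam h).2.1.1
      exact ⟨x, hx, fun _ => hx'⟩
    · exact ⟨0, Metric.mem_closedBall_self (Real.sqrt_nonneg _), fun h' => (h h').elim⟩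
  have hmin : ∀ lam : ℝ, ∃ x ∈ Metric.closedBall (0 : E N) (√N), 0 < lam →
      ∀ y, v lam x ≤ v lam y := fun lam => by
    by_cases h : 0 < lam
    · obtain ⟨x, hx, hx'⟩ := (hv lam h).1.exists_min (hv lam h).2.2.1
      exact ⟨x, hx, fun _ => hx'⟩
    · exact ⟨0, Metric.mem_closedBall_self (Real.sqrt_nonneg _), fun h' => (h h').elim⟩
  choose X hXm hX using hmax
  choose Y hYm hY using hmin
  refine mem_iff_ultrafilter.2 fun U hU => ?_
  have hlim : ∀ Z : ℝ → E N, (∀ lam, Z lam ∈ Metric.closedBall (0 : E N) (√N)) →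
      ∃ z, Tendsto Z U (𝓝 z) := fun Z hZ => by
    obtain ⟨z, -, hz⟩ := (isCompact_closedBall (0 : E N) (√N)).ultrafilter_le_nhds (U.map Z)
      (le_principal_iff.2 (mem_map.2 (univ_mem' hZ)))
    exact ⟨z, hz⟩
  obtain ⟨x, hx⟩ := hlim X hXm
  obtain ⟨y, hy⟩ := hlim Y hYm
  have hclose : ∀ (Z : ℝ → E N) (z : E N), Tendsto Z U (𝓝 z) → ∀ η : ℝ, 0 < η →
      ∀ᶠ lam in (U : Filter ℝ), lam * v lam (Z lam) - lam * v lam z ≤ η ∧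
        lam * v lam z - lam * v lam (Z lam) ≤ η := fun Z z hZ η hη => by
    obtain ⟨K, hK, h⟩ := hequi (η / 2) (by positivity)
    have h1 : Tendsto (fun lam => K * ‖Z lam - z‖ ^ 2) U (𝓝 (K * ‖z - z‖ ^ 2)) :=
      ((hZ.sub_const z).norm.pow 2).const_mul K
    rw [sub_self, norm_zero, zero_pow two_ne_zero, mul_zero] at h1
    filter_upwards [h1.eventually_lt_const (half_pos hη), hU self_mem_nhdsWithin] with lam h2 h3
    have h4 := h lam h3 (Z lam) z
    have h5 := h lam h3 z (Z lam)
    rw [norm_sub_rev] at h5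
    exact ⟨by linarith, by linarith⟩
  have hprop := asymptotically_max_of_controllable hctrl
    (P := fun y => ∀ e : ℝ, 0 < e → ∀ᶠ lam in (U : Filter ℝ),
      lam * v lam (X lam) - lam * v lam y ≤ e)
    (fun k y h e he => by
      filter_upwards [h e he, hU self_mem_nhdsWithin] with lam h1 h2
      rwa [(hv lam h2).1 k] at h1)
    (fun y y' hjump h => asymptotically_max_of_jump hB hβ hμ ha₀ ha hC₀ hf₀ hv hequi hU
      (S := fun lam => lam * v lam (X lam))
      (fun lam hlam y => mul_le_mul_of_nonneg_left (hX lam hlam y) hlam.le) hjump h)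
    (fun η hη => (hclose X x hx η hη).mono fun _ h => h.1) y
  filter_upwards [hprop (e / 2) (half_pos he), hclose Y y hy (e / 2) (half_pos he),
    hU self_mem_nhdsWithin] with lam h1 h2 h3 p q
  have hlam : 0 < lam := h3
  have h4 := mul_le_mul_of_nonneg_left (hX lam hlam p) hlam.le
  have h5 := mul_le_mul_of_nonneg_left (hY lam hlam q) hlam.le
  linarith [h2.2]

/-! ### The ergodic constant -/

lemma IsViscositySubsolution.of_lower_bound {form : Form} {M N : ℕ} {β : E M → E N}
    {μ : Measure (E M)} {a f₀ : E N → ℝ} {lam d δ : ℝ} {v : E N → ℝ}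
    (hv : IsViscositySubsolution form β μ a (fun y r => lam * r - f₀ y) 0 v)
    (h : ∀ y, d - δ ≤ lam * v y) :
    IsViscositySubsolution form β μ a (fun y _ => d - f₀ y) δ v :=
  ⟨hv.1, fun y φ hφ h1 h2 => ⟨(hv.2 y φ hφ h1 h2).1, by
    linarith [(hv.2 y φ hφ h1 h2).2, h y]⟩⟩

lemma IsViscositySupersolution.of_upper_bound {form : Form} {M N : ℕ} {β : E M → E N}
    {μ : Measure (E M)} {a f₀ : E N → ℝ} {lam d δ : ℝ} {v : E N → ℝ}
    (hv : IsViscositySupersolution form β μ a (fun y r => lam * r - f₀ y) 0 v)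
    (h : ∀ y, lam * v y ≤ d + δ) :
    IsViscositySupersolution form β μ a (fun y _ => d - f₀ y) (-δ) v :=
  ⟨hv.1, fun y φ hφ h1 h2 => ⟨(hv.2 y φ hφ h1 h2).1, by
    linarith [(hv.2 y φ hφ h1 h2).2, h y]⟩⟩

end LevyErgodic

theorem theorem3p1 (form : LevyErgodic.Form) {M N : ℕ} (hMN : M ≤ N)
    -- the jump function
    (β : LevyErgodic.E M → LevyErgodic.E N) (hβ_cont : Continuous β)
    (hβ_hom : ∀ (c : ℝ) (z : LevyErgodic.E M), 0 < c → β (c • z) = c • β z)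
    (B₁ : ℝ) (hB₁ : 0 < B₁) (hβ_bound : ∀ z, ‖β z‖ ≤ B₁ * ‖z‖)
    -- the Lévy density
    (q₀ : LevyErgodic.E M → ℝ) (hq₀_meas : Measurable q₀) (hq₀_nonneg : ∀ z, 0 ≤ q₀ z)
    (hq₀_int : LevyErgodic.LevyIntegrable form.order (LevyErgodic.densityMeasure q₀))
    (hq₀_B : LevyErgodic.Controllable β (LevyErgodic.densityMeasure q₀))
    -- the periodic Hölder continuous coefficients
    (a f₀ : LevyErgodic.E N → ℝ)
    (ha_per : LevyErgodic.Periodic a) (hf₀_per : LevyErgodic.Periodic f₀)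
    (a₀ L θ₁ θ₂ : ℝ) (ha₀ : 0 < a₀) (hL : 0 < L)
    (hθ₁ : θ₁ ∈ Set.Ioc (0 : ℝ) 1) (hθ₂ : θ₂ ∈ Set.Ioc (0 : ℝ) 1)
    (ha_lower : ∀ y, a₀ ≤ a y)
    (ha_holder : ∀ y y', |a y - a y'| ≤ L * ‖y - y'‖ ^ θ₁)
    (hf₀_holder : ∀ y y', |f₀ y - f₀ y'| ≤ L * ‖y - y'‖ ^ θ₂)
    -- the solutions
    (v : ℝ → LevyErgodic.E N → ℝ)
    (hv : ∀ lam : ℝ, 0 < lam →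
      LevyErgodic.SolvesErgodic form β (LevyErgodic.densityMeasure q₀) a f₀ lam (v lam)) :
    ∃ d : ℝ,
      TendstoUniformly (fun (lam : ℝ) (y : LevyErgodic.E N) => lam * v lam y) (fun _ => d)
        (𝓝[>] (0 : ℝ)) ∧
      (∀ d' : ℝ, TendstoUniformly (fun (lam : ℝ) (y : LevyErgodic.E N) => lam * v lam y)
        (fun _ => d') (𝓝[>] (0 : ℝ)) → d' = d) ∧
      (∀ d' : ℝ, LevyErgodic.SolvesCellApproximately form β (LevyErgodic.densityMeasure q₀)
        a f₀ d' ↔ d' = d) := by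
  open LevyErgodic in
  have : SigmaFinite (densityMeasure q₀) := SigmaFinite.withDensity_ofReal q₀
  obtain ⟨C₀, hC₀, hf₀⟩ := hf₀_per.exists_abs_le hL hθ₂.1 hf₀_holder
  have hosc := fun (e : ℝ) (he : 0 < e) => eventually_oscillation_le hB₁.le hβ_bound hq₀_int hq₀_B
    ha₀ ha_lower hC₀ hf₀ hv (fun η hη => exists_equicontinuity hf₀_per ha₀ hL hθ₁ hθ₂ ha_lower
      ha_holder hf₀_holder hv hη) he
  have hcomp : ∀ lam lam' e : ℝ, 0 < lam → 0 < lam' →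
      (∀ x y, lam * v lam x - lam * v lam y ≤ e) →
      (∀ x y, lam' * v lam' x - lam' * v lam' y ≤ e) →
      lam * v lam 0 ≤ lam' * v lam' 0 + (e + e) := fun lam lam' e hlam hlam' h h' =>
    cell_comparison hf₀_per ha₀ hL hθ₁ hθ₂ ha_lower ha_holder hf₀_holder
      (hv lam hlam).1 (hv lam' hlam').1
      ((hv lam hlam).2.1.of_lower_bound fun y => by linarith [h 0 y])
      ((hv lam' hlam').2.2.of_upper_bound fun y => by linarith [h' y 0])
  have hcauchy : Cauchy (map (fun lam : ℝ => lam * v lam 0) (𝓝[>] (0 : ℝ))) := by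
    refine Metric.cauchy_iff.2 ⟨inferInstance, fun ε hε => ?_⟩
    refine ⟨_, image_mem_map ((hosc (ε / 3) (by positivity)).and self_mem_nhdsWithin), ?_⟩
    rintro _ ⟨lam, ⟨h, hlam⟩, rfl⟩ _ ⟨lam', ⟨h', hlam'⟩, rfl⟩
    have h1 := hcomp lam lam' _ hlam hlam' h h'
    have h2 := hcomp lam' lam _ hlam' hlam h' h
    rw [Real.dist_eq]
    exact abs_lt.2 ⟨by linarith, by linarith⟩
  obtain ⟨d, hd⟩ := CompleteSpace.complete hcauchy
  have hunif : TendstoUniformly (fun (lam : ℝ) (y : E N) => lam * v lam y) (fun _ => d)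
      (𝓝[>] (0 : ℝ)) := by
    refine Metric.tendstoUniformly_iff.2 fun ε hε => ?_
    have hd' : ∀ᶠ lam in 𝓝[>] (0 : ℝ), dist (lam * v lam 0) d < ε / 2 :=
      (Metric.tendsto_nhds.1 hd) _ (half_pos hε)
    filter_upwards [hosc (ε / 2) (half_pos hε), hd'] with lam h1 h2 y
    rw [Real.dist_eq] at h2 ⊢
    obtain ⟨h3, h4⟩ := abs_lt.1 h2
    exact abs_lt.2 ⟨by linarith [h1 y 0], by linarith [h1 0 y]⟩
  have hcell : SolvesCellApproximately form β (densityMeasure q₀) a f₀ d := fun δ hδ => by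
    obtain ⟨lam, h, hlam⟩ :=
      ((Metric.tendstoUniformly_iff.1 hunif δ hδ).and self_mem_nhdsWithin).exists
    have h' : ∀ y, |d - lam * v lam y| < δ := h
    have hs := hv lam hlam
    exact ⟨⟨_, hs.1, hs.2.1.of_lower_bound fun y => by linarith [(abs_lt.1 (h' y)).2]⟩,
      ⟨_, hs.1, hs.2.2.of_upper_bound fun y => by linarith [(abs_lt.1 (h' y)).1]⟩⟩
  have hle : ∀ d₁ d₂ : ℝ, SolvesCellApproximately form β (densityMeasure q₀) a f₀ d₁ →
      SolvesCellApproximately form β (densityMeasure q₀) a f₀ d₂ → d₁ ≤ d₂ :=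
    fun d₁ d₂ h₁ h₂ => le_of_forall_pos_le_add fun ε hε => by
      obtain ⟨⟨w, hw, hw'⟩, -⟩ := h₁ (ε / 2) (half_pos hε)
      obtain ⟨-, w', hw₂, hw₂'⟩ := h₂ (ε / 2) (half_pos hε)
      have := cell_comparison hf₀_per ha₀ hL hθ₁ hθ₂ ha_lower ha_holder hf₀_holder hw hw₂ hw' hw₂'
      linarith
  refine ⟨d, hunif, fun d' h => ?_, fun d' => ⟨fun h => ?_, fun h => h ▸ hcell⟩⟩
  · exact tendsto_nhds_unique (h.tendsto_at 0) (hunif.tendsto_at 0)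
  · exact le_antisymm (hle _ _ h hcell) (hle _ _ hcell h)
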